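/- Let $n,d\ge 1$ be integers and let $B^n$ be the closed unit ball of $\mathbb R^n$. For a function $f$ of class $C^{d+1}$ on $B^n$ and $0\le l\le d+1$, let $M_l(f)$ be the maximum over $z\in B^n$ of the largest absolute value of a partial derivative of $f$ of order $l$ at $z$. For a subset $Z$ of the concentric closed ball $\hat B^n$ of radius $\frac13$, let $\mathcal{RG}_d(Z)$ be the infimum of $M_{d+1}(f)$ over all $C^{d+1}$ functions $f:B^n\to\mathbb R$ that vanish on $Z$ and satisfy $M_0(f)=1$. Let $0<h<s\le\frac1{10}$, and let $Z\subset \hat B^n$ be a finite $h$-dense set in $Q^n_s=[0,s]^n$, i.e. $Z\subset Q^n_s$ and every closed axis-parallel sub-cube of $Q^n_s$ with side $h$ contains a point of $Z$. Assume also that the minimal (Euclidean) distance between distinct points of $Z$ is $\frac h3$. Put $K_1=2\cdot 3^{n-1}(4d)^n$. If $h\le K_1^{-1}s^n$, then $$\mathcal{RG}_d(Z)\ \ge\ \frac{(d+1)!}{2}\Big(\frac{s}{12n}\Big)^{nd}.$$ -/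

import Mathlib

open scoped ENNReal Nat

noncomputable section

namespace Rigidity

/-- The closed unit ball of Euclidean `n`-space. -/
abbrev unitBall (n : ℕ) : Set (EuclideanSpace ℝ (Fin n)) := Metric.closedBall 0 1

/-- The concentric closed ball of radius `1/3`. -/
abbrev smallBall (n : ℕ) : Set (EuclideanSpace ℝ (Fin n)) := Metric.closedBall 0 (1 / 3)

/-- The partial derivative `∂^l f / ∂x_{i 0} ⋯ ∂x_{i (l-1)}` at `z` of a function `f` on the closed
unit ball (one-sided at the boundary; only the values of `f` on the ball matter). -/
def partialDeriv {n l : ℕ} (i : Fin l → Fin n) (f : EuclideanSpace ℝ (Fin n) → ℝ)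
    (z : EuclideanSpace ℝ (Fin n)) : ℝ :=
  iteratedFDerivWithin ℝ l f (unitBall n) z (fun k => EuclideanSpace.single (i k) (1 : ℝ))

/-- `M_l(f)`: the supremum over the closed unit ball of the largest absolute value of a partial
derivative of order `l`. It is taken in `[0, ∞]`; for `f` of class `C^l` on the ball it is a
maximum, hence finite. -/
def derivMax {n : ℕ} (l : ℕ) (f : EuclideanSpace ℝ (Fin n) → ℝ) : ℝ≥0∞ :=
  ⨆ z ∈ unitBall n, ⨆ i : Fin l → Fin n, ENNReal.ofReal |partialDeriv i f z|

/-- `U_d(Z)`: the functions of class `C^{d+1}` on the closed unit ball that vanish on `Z` and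
satisfy `M_0(f) = 1`. -/
def normalizedVanishing {n : ℕ} (d : ℕ) (Z : Set (EuclideanSpace ℝ (Fin n))) :
    Set (EuclideanSpace ℝ (Fin n) → ℝ) :=
  {f | ContDiffOn ℝ ((d + 1 : ℕ) : ℕ∞) f (unitBall n) ∧ (∀ z ∈ Z, f z = 0) ∧ derivMax 0 f = 1}

/-- The `d`-th rigidity constant of a set `Z` contained in the ball of radius `1/3`:
the infimum of `M_{d+1}(f)` over `f ∈ U_d(Z)`. -/
def rigidity {n : ℕ} (d : ℕ) (Z : Set (EuclideanSpace ℝ (Fin n))) : ℝ≥0∞ :=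
  ⨅ f ∈ normalizedVanishing d Z, derivMax (d + 1) f

/-- The closed axis-parallel cube `a + [0, r]^n`. -/
def cube {n : ℕ} (a : EuclideanSpace ℝ (Fin n)) (r : ℝ) : Set (EuclideanSpace ℝ (Fin n)) :=
  {x | ∀ i, a i ≤ x i ∧ x i ≤ a i + r}

/-- A finite subset `Z` of `[0, s]^n` is `h`-dense if each sub-cube of `[0, s]^n` of side `h`
contains a point of `Z`. -/
structure IsHDense {n : ℕ} (s h : ℝ) (Z : Set (EuclideanSpace ℝ (Fin n))) : Prop where
  finite : Z.Finite
  subset_cube : Z ⊆ cube 0 s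
  meets : ∀ a : EuclideanSpace ℝ (Fin n), cube a h ⊆ cube 0 s → (Z ∩ cube a h).Nonempty

end Rigidity

end

namespace Rigidity

open Polynomial Set

/-! A `C^{d+1}` function `f` vanishing on `Z`, with order `d+1` partials bounded by `M`, is shown to
be at most an explicit multiple of `M` on the whole ball; evaluating where `|f| ≥ 1` bounds `M`
below. For `n ≥ 2`, let `m` be the maximum of `|f|` on the cube. Taylor approximation and Markov's
inequality bound the first partials on the cube in terms of `m` and `M`. The maximum point is within
`h` of a zero in each coordinate, so the mean value inequality gives `m ≤ (m + ε)/2`, hence `m ≤ ε`,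
with `ε` of size `M s^{d+1}` (`abs_le_on_cube`). Chebyshev growth along segments from the cube's
centre carries this to the ball; the growth factor `s^{-d}` is absorbed by `ε` (`le_mul_of_dense`).
Markov costs `d ^ 2`, which the `d ^ n` in `K₁` covers only if `n ≥ 2`. For `n = 1`, `Z` contains `d
+ 1` distinct zeros and the Lagrange remainder suffices (`factorial_le_of_dense_one`). -/

/-! ### Extremality of Chebyshev polynomials: growth and Markov's inequality. -/

theorem eval_chebyshev_T_le_two_mul_pow (d : ℕ) {x : ℝ} (hx : 1 ≤ x) :
    (Chebyshev.T ℝ d).eval x ≤ (2 * x) ^ d := by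
  induction d with
  | zero => simp
  | succ k ih =>
    -- Positivity allows dropping the subtracted term of the three-term recurrence; integer indices
    -- are needed since `k = 0` involves `T_{-1}`.
    have hpos : ∀ j : ℤ, 0 ≤ (Chebyshev.T ℝ j).eval x := by
      intro j
      obtain ⟨y, rfl⟩ : ∃ y, Real.cosh y = x := ⟨Real.arcosh x, Real.cosh_arcosh hx⟩
      rw [Chebyshev.T_real_cosh]
      exact (Real.cosh_pos _).le
    have h := Chebyshev.T_add_two ℝ ((k : ℤ) - 1)
    have e1 : (k : ℤ) - 1 + 2 = ((k + 1 : ℕ) : ℤ) := by push_cast; ring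
    rw [e1, sub_add_cancel] at h
    rw [h]
    simp only [eval_sub, eval_mul, eval_ofNat, eval_X]
    have := hpos ((k : ℤ) - 1)
    have h2 : 2 * x * (Chebyshev.T ℝ k).eval x ≤ 2 * x * (2 * x) ^ k := by gcongr
    rw [pow_succ']
    linarith

/-- Chebyshev extremality rescaled, applied to `q` and `-q`. Dividing by the bound needs it
positive, so it is proved for every `c > m` and `c` tends to `m`. -/
theorem abs_eval_iterate_derivative_le {d : ℕ} {q : ℝ[X]} (hq : q.natDegree ≤ d) {m : ℝ}
    (hm : ∀ x ∈ Icc (-1 : ℝ) 1, |q.eval x| ≤ m) (k : ℕ) {x : ℝ} (hx : 1 ≤ x) :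
    |(derivative^[k] q).eval x| ≤ m * (derivative^[k] (Chebyshev.T ℝ d)).eval x := by
  have key : ∀ p : ℝ[X], p.natDegree ≤ d → ∀ c > 0, (∀ x ∈ Icc (-1 : ℝ) 1, |p.eval x| ≤ c) →
      (derivative^[k] p).eval x ≤ c * (derivative^[k] (Chebyshev.T ℝ d)).eval x := by
    intro p hp c hc h
    have h1 : (C c⁻¹ * p).degree ≤ d := by
      refine degree_le_of_natDegree_le ((natDegree_C_mul_le _ _).trans hp)
    have h2 := Chebyshev.eval_iterate_derivative_le_of_forall_abs_le_one (n := d) (k := k) hx h1 (by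
      intro y hy
      rw [eval_mul, eval_C, abs_mul, abs_of_pos (inv_pos.2 hc), inv_mul_le_iff₀ hc, mul_one]
      exact h y hy)
    rw [iterate_derivative_C_mul, eval_mul, eval_C, inv_mul_le_iff₀ hc] at h2
    exact h2
  have key' : ∀ c > 0, (∀ x ∈ Icc (-1 : ℝ) 1, |q.eval x| ≤ c) →
      |(derivative^[k] q).eval x| ≤ c * (derivative^[k] (Chebyshev.T ℝ d)).eval x := by
    intro c hc h
    refine abs_le'.2 ⟨key q hq c hc h, ?_⟩
    have := key (-q) (by simpa using hq) c hc (by simpa using h)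
    simpa [iterate_derivative_neg] using this
  have hm0 : 0 ≤ m := (abs_nonneg _).trans (hm 0 (by simp))
  refine ge_of_tendsto (x := nhdsWithin m (Ioi m)) (f := fun c => c * (derivative^[k] (Chebyshev.T ℝ d)).eval x) ?_ ?_
  · exact ((continuous_id.mul continuous_const).tendsto m).mono_left nhdsWithin_le_nhds
  · filter_upwards [self_mem_nhdsWithin] with c hc
    exact key' c (hm0.trans_lt hc) fun y hy => (hm y hy).trans (le_of_lt hc)

/-- Growth of a polynomial outside an interval on which it is bounded. -/
theorem abs_eval_one_le_of_forall_abs_le {d : ℕ} {q : ℝ[X]} (hq : q.natDegree ≤ d) {m τ : ℝ}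
    (hτ : 0 < τ) (hτ1 : τ ≤ 1) (hm : ∀ x ∈ Icc 0 τ, |q.eval x| ≤ m) :
    |q.eval 1| ≤ m * (4 / τ) ^ d := by
  have hm0 : 0 ≤ m := (abs_nonneg _).trans (hm 0 ⟨le_rfl, hτ.le⟩)
  -- This substitution maps `[-1, 1]` onto `[0, τ]` and `2 / τ - 1` to `1`.
  set r : ℝ[X] := q.comp (C (τ / 2) * X + C (τ / 2)) with hr
  have hrd : r.natDegree ≤ d := by
    refine natDegree_comp_le.trans ?_
    calc _ ≤ q.natDegree * 1 := Nat.mul_le_mul_left _ natDegree_linear_le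
      _ ≤ d := by simpa using hq
  have hx : 1 ≤ 2 / τ - 1 := by
    rw [le_sub_iff_add_le, le_div_iff₀ hτ]; linarith
  have h1 := abs_eval_iterate_derivative_le hrd (m := m) (by
    intro x hx
    simp only [hr, eval_comp, eval_add, eval_mul, eval_C, eval_X]
    exact hm _ ⟨by nlinarith [hx.1], by nlinarith [hx.2]⟩) 0 hx
  simp only [Function.iterate_zero, id] at h1
  have e : r.eval (2 / τ - 1) = q.eval 1 := by
    simp only [hr, eval_comp, eval_add, eval_mul, eval_C, eval_X]
    congr 1
    field_simp
    ring
  rw [e] at h1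
  refine h1.trans (mul_le_mul_of_nonneg_left ?_ hm0)
  refine (eval_chebyshev_T_le_two_mul_pow d hx).trans ?_
  gcongr
  have : 4 / τ = 2 * (2 / τ) := by ring
  rw [this]
  linarith

/-- Markov's inequality at the left endpoint of an interval. -/
theorem abs_eval_derivative_zero_le {d : ℕ} {q : ℝ[X]} (hq : q.natDegree ≤ d) {m r : ℝ}
    (hr : 0 < r) (hm : ∀ x ∈ Icc 0 r, |q.eval x| ≤ m) :
    |q.derivative.eval 0| ≤ 2 * (d : ℝ) ^ 2 / r * m := by
  -- Orientation is reversed so that `1` maps to `0`, where `T_d'(1) = d ^ 2` applies.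
  set p : ℝ[X] := q.comp (C (-r / 2) * X + C (r / 2)) with hp
  have hpd : p.natDegree ≤ d := by
    refine natDegree_comp_le.trans ?_
    calc _ ≤ q.natDegree * 1 := Nat.mul_le_mul_left _ natDegree_linear_le
      _ ≤ d := by simpa using hq
  have h1 := abs_eval_iterate_derivative_le hpd (m := m) (by
    intro x hx
    simp only [hp, eval_comp, eval_add, eval_mul, eval_C, eval_X]
    exact hm _ ⟨by nlinarith [hx.2], by nlinarith [hx.1]⟩) 1 le_rfl
  simp only [Function.iterate_one, Chebyshev.derivative_T_eval_one] at h1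
  have e : p.derivative.eval 1 = -r / 2 * q.derivative.eval 0 := by
    have : -r / 2 + r / 2 = 0 := by ring
    simp [hp, derivative_comp, this]
  rw [e, abs_mul, abs_div, abs_neg, abs_of_pos hr, abs_two] at h1
  push_cast at h1
  rw [div_mul_eq_mul_div, le_div_iff₀ hr]
  linarith

/-! ### One-variable estimates by Taylor approximation. -/

/-- Taylor approximation at the left endpoint of an interval by a genuine polynomial. -/
theorem exists_polynomial_taylor {g : ℝ → ℝ} {d : ℕ} (hd : 1 ≤ d) {r K : ℝ} (hr : 0 < r)
    (hg : ContDiffOn ℝ (d + 1) g (Icc 0 r))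
    (hK : ∀ t ∈ Icc 0 r, |iteratedDerivWithin (d + 1) g (Icc 0 r) t| ≤ K) :
    ∃ q : ℝ[X], q.natDegree ≤ d ∧ q.derivative.eval 0 = derivWithin g (Icc 0 r) 0 ∧
      ∀ t ∈ Icc 0 r, |g t - q.eval t| ≤ K * t ^ (d + 1) / d ! := by
  set q : ℝ[X] := ∑ k ∈ Finset.range (d + 1),
    C ((k ! : ℝ)⁻¹ * iteratedDerivWithin k g (Icc 0 r) 0) * X ^ k with hq
  refine ⟨q, ?_, ?_, ?_⟩
  · refine natDegree_sum_le_of_forall_le _ _ fun k hk => ?_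
    exact (natDegree_C_mul_X_pow_le _ _).trans (Nat.lt_succ_iff.1 (Finset.mem_range.1 hk))
  · have : q.derivative.eval 0 = q.coeff 1 := by
      rw [← coeff_zero_eq_eval_zero, coeff_derivative]; simp
    rw [this, hq, finsetSum_coeff]
    simp only [coeff_C_mul, coeff_X_pow]
    rw [Finset.sum_eq_single 1 (by intro b _ hb; simp [hb.symm])
      (by intro h; simp at h; omega)]
    simp [iteratedDerivWithin_one]
  · intro t ht
    -- This remainder carries `d !` rather than `(d + 1)!`; the lost factor `d + 1` is recovered in
    -- `factorial_bound_mul_le_one`.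
    have h := taylor_mean_remainder_bound hr.le hg ht (by simpa using hK)
    have e : taylorWithinEval g d (Icc 0 r) 0 t = q.eval t := by
      rw [taylor_within_apply, hq, eval_finsetSum]
      refine Finset.sum_congr rfl fun k _ => ?_
      simp
      ring
    rw [e] at h
    simpa using h

/-- A Landau–Kolmogorov type bound for the first derivative at the left endpoint. -/
theorem abs_derivWithin_zero_le {g : ℝ → ℝ} {d : ℕ} (hd : 1 ≤ d) {r K m : ℝ} (hr : 0 < r)
    (hg : ContDiffOn ℝ (d + 1) g (Icc 0 r))
    (hK : ∀ t ∈ Icc 0 r, |iteratedDerivWithin (d + 1) g (Icc 0 r) t| ≤ K)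
    (hm : ∀ t ∈ Icc 0 r, |g t| ≤ m) :
    |derivWithin g (Icc 0 r) 0| ≤ 2 * (d : ℝ) ^ 2 / r * (m + K * r ^ (d + 1) / d !) := by
  obtain ⟨q, hqd, hq0, hq⟩ := exists_polynomial_taylor hd hr hg hK
  have hK0 : 0 ≤ K := (abs_nonneg _).trans (hK 0 ⟨le_rfl, hr.le⟩)
  rw [← hq0]
  refine abs_eval_derivative_zero_le hqd hr fun t ht => ?_
  have h1 : K * t ^ (d + 1) / d ! ≤ K * r ^ (d + 1) / d ! := by
    gcongr
    exacts [ht.1, ht.2]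
  have := abs_sub_abs_le_abs_sub (q.eval t) (g t)
  rw [abs_sub_comm] at this
  linarith [hq t ht, hm t ht]

/-- Propagation of smallness from an initial segment to the whole of `[0, 1]`. -/
theorem abs_apply_one_le {g : ℝ → ℝ} {d : ℕ} (hd : 1 ≤ d) {τ K m : ℝ} (hτ : 0 < τ) (hτ1 : τ ≤ 1)
    (hg : ContDiffOn ℝ (d + 1) g (Icc 0 1))
    (hK : ∀ t ∈ Icc (0 : ℝ) 1, |iteratedDerivWithin (d + 1) g (Icc 0 1) t| ≤ K)
    (hm : ∀ t ∈ Icc 0 τ, |g t| ≤ m) :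
    |g 1| ≤ (m + K * τ ^ (d + 1) / d !) * (4 / τ) ^ d + K / d ! := by
  obtain ⟨q, hqd, -, hq⟩ := exists_polynomial_taylor hd one_pos hg hK
  have hK0 : 0 ≤ K := (abs_nonneg _).trans (hK 0 (by simp))
  have h1 := abs_eval_one_le_of_forall_abs_le hqd hτ hτ1 (m := m + K * τ ^ (d + 1) / d !) (by
    intro t ht
    have h1 : K * t ^ (d + 1) / d ! ≤ K * τ ^ (d + 1) / d ! := by
      gcongr
      exacts [ht.1, ht.2]
    have := abs_sub_abs_le_abs_sub (q.eval t) (g t)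
    rw [abs_sub_comm] at this
    linarith [hq t ⟨ht.1, ht.2.trans hτ1⟩, hm t ht])
  have h2 := hq 1 (by simp)
  have := abs_sub_abs_le_abs_sub (g 1) (q.eval 1)
  simp only [one_pow, mul_one] at h2
  linarith

/-! ### Rolle's theorem and the Lagrange remainder. -/

/-- The generalized Rolle theorem. -/
theorem exists_iteratedDerivWithin_eq_zero {a b : ℝ} (hab : a < b) (k : ℕ) :
    ∀ {u : ℝ → ℝ}, ContDiffOn ℝ k u (Icc a b) → ∀ {S : Finset ℝ}, ↑S ⊆ Icc a b →
      S.card = k + 1 → (∀ x ∈ S, u x = 0) →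
      ∃ ξ ∈ Icc a b, iteratedDerivWithin k u (Icc a b) ξ = 0 := by
  induction k with
  | zero =>
    intro u _ S hS hc h0
    obtain ⟨x, hx⟩ : S.Nonempty := Finset.card_pos.1 (by omega)
    exact ⟨x, hS hx, by simpa using h0 x hx⟩
  | succ k ih =>
    intro u hu S hS hc h0
    have hu' : ContDiffOn ℝ k (derivWithin u (Icc a b)) (Icc a b) :=
      hu.derivWithin (uniqueDiffOn_Icc hab) (by norm_cast)
    set e := S.orderEmbOfFin hc
    have he : ∀ i, e i ∈ S := fun i => S.orderEmbOfFin_mem hc i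
    have hroll : ∀ i : Fin (k + 1), ∃ c ∈ Ioo (e i.castSucc) (e i.succ),
        derivWithin u (Icc a b) c = 0 := by
      intro i
      have hlt : e i.castSucc < e i.succ := e.strictMono i.castSucc_lt_succ
      have hsub : Icc (e i.castSucc) (e i.succ) ⊆ Icc a b :=
        Icc_subset_Icc (hS (he _)).1 (hS (he _)).2
      obtain ⟨c, hc, hc0⟩ := exists_deriv_eq_zero hlt (hu.continuousOn.mono hsub)
        ((h0 _ (he _)).trans (h0 _ (he _)).symm)
      refine ⟨c, hc, ?_⟩
      rw [derivWithin_of_mem_nhds, hc0]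
      exact Icc_mem_nhds ((hS (he _)).1.trans_lt hc.1) (hc.2.trans_le (hS (he _)).2)
    choose c hc hc0 using hroll
    -- The Rolle points lie in disjoint open gaps, so they are `k + 1` distinct zeros of the
    -- derivative.
    have hmono : StrictMono c := by
      intro i j hij
      have : e i.succ ≤ e j.castSucc := e.monotone (by
        rw [Fin.le_def]; simpa using hij)
      exact (hc i).2.trans_le (this.trans (hc j).1.le)
    obtain ⟨ξ, hξ, h⟩ := ih hu' (S := Finset.univ.map ⟨c, hmono.injective⟩) (by
        intro x hx
        simp only [Finset.coe_map, Function.Embedding.coeFn_mk, Finset.coe_univ, image_univ,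
          mem_range] at hx
        obtain ⟨i, rfl⟩ := hx
        exact ⟨(hS (he _)).1.trans (hc i).1.le, (hc i).2.le.trans (hS (he _)).2⟩)
      (by simp) (by
        intro x hx
        simp only [Finset.mem_map, Finset.mem_univ, true_and, Function.Embedding.coeFn_mk] at hx
        obtain ⟨i, rfl⟩ := hx
        exact hc0 i)
    exact ⟨ξ, hξ, by rw [iteratedDerivWithin_succ']; exact h⟩

theorem iterate_deriv_eval (p : ℝ[X]) (k : ℕ) :
    deriv^[k] (fun y => p.eval y) = fun y => (derivative^[k] p).eval y := by
  induction k with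
  | zero => rfl
  | succ k ih =>
    rw [Function.iterate_succ_apply', ih, Function.iterate_succ_apply']
    ext y
    exact Polynomial.deriv _

/-- The remainder of Lagrange interpolation for a function vanishing at the nodes. -/
theorem exists_eq_iteratedDerivWithin_mul_prod {a b : ℝ} (hab : a < b) {k : ℕ} {g : ℝ → ℝ}
    (hg : ContDiffOn ℝ k g (Icc a b)) {S : Finset ℝ} (hS : ↑S ⊆ Icc a b) (hc : S.card = k)
    (h0 : ∀ z ∈ S, g z = 0) {x : ℝ} (hx : x ∈ Icc a b) :
    ∃ ξ ∈ Icc a b, k ! * g x = iteratedDerivWithin k g (Icc a b) ξ * ∏ z ∈ S, (x - z) := by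
  by_cases hxS : x ∈ S
  · exact ⟨x, hx, by rw [h0 x hxS, Finset.prod_eq_zero hxS (sub_self x)]; simp⟩
  have hω : ∏ z ∈ S, (x - z) ≠ 0 := by
    refine Finset.prod_ne_zero_iff.2 fun z hz h => hxS ?_
    rwa [sub_eq_zero.1 h]
  set ω : ℝ[X] := Lagrange.nodal S id with hωd
  have hωx : ∀ y, ω.eval y = ∏ z ∈ S, (y - z) := fun y => by simp [hωd, Lagrange.eval_nodal]
  -- The scaling makes `g - p` vanish at `x` as well as at the nodes, giving `k + 1` zeros. As `ω`
  -- is monic of degree `k`, the `k`-th derivative of `p` is constant.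
  set p : ℝ[X] := C (g x / ω.eval x) * ω with hp
  have hpc : ContDiff ℝ k (fun y => p.eval y) := by
    have h : ContDiff ℝ k (fun y : ℝ => aeval y p) := p.contDiff_aeval k
    simpa only [coe_aeval_eq_eval] using h
  obtain ⟨ξ, hξ, h⟩ := exists_iteratedDerivWithin_eq_zero hab k (u := g - fun y => p.eval y)
    (hg.sub hpc.contDiffOn) (S := insert x S)
    (by rw [Finset.coe_insert]; exact insert_subset hx hS)
    (by rw [Finset.card_insert_of_notMem hxS, hc]) (by
      intro y hy
      rw [Pi.sub_apply]
      rcases Finset.mem_insert.1 hy with rfl | hy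
      · rw [hp, eval_mul, eval_C, div_mul_cancel₀ _ (by rwa [hωx]), sub_self]
      · rw [h0 y hy, hp, eval_mul, hωx y, Finset.prod_eq_zero hy (sub_self y)]; simp)
  refine ⟨ξ, hξ, ?_⟩
  have hI := uniqueDiffOn_Icc hab
  have h1 : iteratedDerivWithin k (fun y => p.eval y) (Icc a b) ξ = k ! * (g x / ω.eval x) := by
    rw [iteratedDerivWithin_eq_iteratedDeriv hI hpc.contDiffAt hξ, iteratedDeriv_eq_iterate,
      iterate_deriv_eval]
    simp only [hp, iterate_derivative_C_mul, eval_mul, eval_C]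
    rw [mul_comm]
    congr 1
    have hdeg : ω.natDegree = k := by rw [hωd, Lagrange.natDegree_nodal, hc]
    have hz : (derivative^[k] ω).natDegree = 0 := by
      have := natDegree_iterate_derivative ω k
      omega
    rw [eq_C_of_natDegree_eq_zero hz, eval_C, coeff_iterate_derivative, zero_add,
      Nat.descFactorial_self]
    have : ω.coeff k = 1 := by
      rw [← hdeg]; exact Lagrange.nodal_monic
    simp [this]
  rw [iteratedDerivWithin_sub hξ hI (hg ξ hξ) hpc.contDiffWithinAt, h1, sub_eq_zero] at h
  rw [h, hωx]
  field_simp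

/-! ### Restriction of functions on the ball to segments. -/

/-- Iterated derivatives along a segment. -/
theorem iteratedDerivWithin_comp_segment {E : Type*} [NormedAddCommGroup E] [NormedSpace ℝ E]
    {D : ℕ} {f : E → ℝ} {s : Set E} (hs : UniqueDiffOn ℝ s) (hf : ContDiffOn ℝ D f s) {p w : E}
    {a b : ℝ} (hab : a < b) (hmaps : ∀ t ∈ Icc a b, p + t • w ∈ s) {k : ℕ} (hk : k ≤ D) :
    ∀ t ∈ Icc a b, iteratedDerivWithin k (fun t => f (p + t • w)) (Icc a b) t =
      iteratedFDerivWithin ℝ k f s (p + t • w) (fun _ => w) := by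
  have hI := uniqueDiffOn_Icc hab
  induction k with
  | zero => intro t _; simp
  | succ k ih =>
    intro t ht
    have ih := ih (by omega)
    rw [iteratedDerivWithin_succ, derivWithin_congr ih (ih t ht),
      iteratedFDerivWithin_succ_apply_left]
    have h1 : HasFDerivWithinAt (iteratedFDerivWithin ℝ k f s)
        (fderivWithin ℝ (iteratedFDerivWithin ℝ k f s) s (p + t • w)) s (p + t • w) :=
      (hf.differentiableOn_iteratedFDerivWithin (by exact_mod_cast hk) hs _
        (hmaps t ht)).hasFDerivWithinAt
    have h2 : HasDerivWithinAt (fun t : ℝ => p + t • w) w (Icc a b) t := by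
      simpa using (((hasDerivAt_id t).smul_const w).const_add p).hasDerivWithinAt
    have h3 := h1.comp_hasDerivWithinAt t h2 hmaps
    have h4 := ((ContinuousMultilinearMap.apply ℝ (fun _ : Fin k => E) ℝ
      (fun _ => w)).hasFDerivAt).comp_hasDerivWithinAt t h3
    exact h4.derivWithin (hI t ht)

theorem contDiffOn_comp_segment {E : Type*} [NormedAddCommGroup E] [NormedSpace ℝ E]
    {D : WithTop ℕ∞} {f : E → ℝ} {s : Set E} (hf : ContDiffOn ℝ D f s) {p w : E}
    {I : Set ℝ} (hmaps : ∀ t ∈ I, p + t • w ∈ s) :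
    ContDiffOn ℝ D (fun t : ℝ => f (p + t • w)) I :=
  hf.comp (contDiff_const.add (contDiff_id.smul contDiff_const)).contDiffOn hmaps

variable {n : ℕ}

theorem sum_smul_single (w : EuclideanSpace ℝ (Fin n)) :
    ∑ i, w i • EuclideanSpace.single i (1 : ℝ) = w := by
  ext j
  simp [Pi.single_apply]

/-- Multilinear expansion of `w` in the standard basis; control of coordinate partials alone is what
produces the `ℓ¹` norm. -/
theorem abs_iteratedFDerivWithin_apply_le {f : EuclideanSpace ℝ (Fin n) → ℝ} {k : ℕ} {M : ℝ}
    {z : EuclideanSpace ℝ (Fin n)} (hM : ∀ i : Fin k → Fin n, |partialDeriv i f z| ≤ M)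
    (w : EuclideanSpace ℝ (Fin n)) :
    |iteratedFDerivWithin ℝ k f (unitBall n) z (fun _ => w)| ≤ M * (∑ i, |w i|) ^ k := by
  set T := iteratedFDerivWithin ℝ k f (unitBall n) z with hT
  have e : T (fun _ => w) = ∑ i : Fin k → Fin n, (∏ j, w (i j)) * partialDeriv i f z := by
    conv_lhs => rw [← sum_smul_single w]
    rw [T.map_sum (fun _ i => w i • EuclideanSpace.single i (1 : ℝ))]
    refine Finset.sum_congr rfl fun i _ => ?_
    rw [T.map_smul_univ (fun j => w (i j)) (fun j => EuclideanSpace.single (i j) (1 : ℝ))]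
    rfl
  rw [e, mul_comm M, Finset.sum_pow', Fintype.piFinset_univ, Finset.sum_mul]
  refine (Finset.abs_sum_le_sum_abs _ _).trans (Finset.sum_le_sum fun i _ => ?_)
  rw [abs_mul, Finset.abs_prod]
  exact mul_le_mul_of_nonneg_left (hM i) (Finset.prod_nonneg fun _ _ => abs_nonneg _)

theorem uniqueDiffOn_unitBall : UniqueDiffOn ℝ (unitBall n) :=
  uniqueDiffOn_convex (convex_closedBall 0 1) (by
    rw [interior_closedBall _ one_ne_zero]
    exact ⟨0, by simp⟩)

/-- The restriction of a function on the ball to a segment has a controlled top derivative. -/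
theorem abs_iteratedDerivWithin_comp_segment_le {f : EuclideanSpace ℝ (Fin n) → ℝ} {D : ℕ} {M : ℝ}
    (hf : ContDiffOn ℝ D f (unitBall n))
    (hM : ∀ z ∈ unitBall n, ∀ i : Fin D → Fin n, |partialDeriv i f z| ≤ M)
    {p w : EuclideanSpace ℝ (Fin n)} {a b : ℝ} (hab : a < b)
    (hmaps : ∀ t ∈ Icc a b, p + t • w ∈ unitBall n) {t : ℝ} (ht : t ∈ Icc a b) :
    |iteratedDerivWithin D (fun t => f (p + t • w)) (Icc a b) t| ≤ M * (∑ i, |w i|) ^ D := by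
  rw [iteratedDerivWithin_comp_segment uniqueDiffOn_unitBall hf hab hmaps le_rfl t ht]
  exact abs_iteratedFDerivWithin_apply_le (hM _ (hmaps t ht)) w

/-! ### Geometry of the cube. -/

theorem mem_cube_zero {s : ℝ} {x : EuclideanSpace ℝ (Fin n)} :
    x ∈ cube 0 s ↔ ∀ i, 0 ≤ x i ∧ x i ≤ s := by
  simp [cube]

theorem convex_cube (a : EuclideanSpace ℝ (Fin n)) (r : ℝ) : Convex ℝ (cube a r) := by
  have : cube a r = ⋂ i, (EuclideanSpace.proj (𝕜 := ℝ) i) ⁻¹' Icc (a i) (a i + r) := by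
    ext x; simp [cube]
  rw [this]
  exact convex_iInter fun i => (convex_Icc _ _).linear_preimage
    (EuclideanSpace.proj (𝕜 := ℝ) i : EuclideanSpace ℝ (Fin n) →L[ℝ] ℝ).toLinearMap

theorem isCompact_cube_zero {s : ℝ} (h : cube 0 s ⊆ unitBall n) :
    IsCompact (cube (0 : EuclideanSpace ℝ (Fin n)) s) := by
  refine (isCompact_closedBall 0 1).of_isClosed_subset ?_ h
  have : cube (0 : EuclideanSpace ℝ (Fin n)) s =
      ⋂ i, (EuclideanSpace.proj (𝕜 := ℝ) i) ⁻¹' Icc 0 s := by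
    ext x; simp [cube]
  rw [this]
  exact isClosed_iInter fun i => isClosed_Icc.preimage (EuclideanSpace.proj (𝕜 := ℝ) i :
    EuclideanSpace ℝ (Fin n) →L[ℝ] ℝ).continuous

/-- A set meeting the corner cube and contained in the small ball forces the cube into the unit
ball. -/
theorem cube_subset_unitBall {s h : ℝ} {Z : Set (EuclideanSpace ℝ (Fin n))}
    (h0 : 0 < h) (hhs : 2 * h ≤ s) (hZb : Z ⊆ smallBall n) (hZ : IsHDense s h Z) :
    cube 0 s ⊆ unitBall n := by
  -- A point `z` of `Z` in the far corner has coordinates at least `s - h ≥ s / 2`, so `2z`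
  -- dominates the cube coordinatewise, and `‖2z‖ ≤ 2/3`.
  obtain ⟨z, hzZ, hz⟩ := hZ.meets (WithLp.toLp 2 fun _ => s - h) (by
    intro x hx
    rw [mem_cube_zero]
    intro i
    have := hx i
    simp only at this
    constructor <;> linarith)
  have hz3 := hZb hzZ
  rw [smallBall, mem_closedBall_zero_iff] at hz3
  intro x hx
  rw [mem_cube_zero] at hx
  rw [unitBall, mem_closedBall_zero_iff]
  have h1 : ‖x‖ ≤ ‖(2 : ℝ) • z‖ := by
    rw [EuclideanSpace.norm_eq, EuclideanSpace.norm_eq]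
    refine Real.sqrt_le_sqrt (Finset.sum_le_sum fun i _ => ?_)
    have h2 := (hz i).1
    simp only at h2
    refine pow_le_pow_left₀ (norm_nonneg _) ?_ 2
    rw [Real.norm_eq_abs, Real.norm_eq_abs, abs_of_nonneg (hx i).1]
    refine le_trans ?_ (le_abs_self _)
    simp only [PiLp.smul_apply, smul_eq_mul]
    linarith [(hx i).2]
  rw [norm_smul, Real.norm_ofNat] at h1
  linarith

/-- Every point of the cube is within sup-distance `h` of an `h`-dense set. -/
theorem IsHDense.exists_near {s h : ℝ} {Z : Set (EuclideanSpace ℝ (Fin n))}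
    (hhs : h ≤ s) (h0 : 0 ≤ h) (hZ : IsHDense s h Z) {x : EuclideanSpace ℝ (Fin n)}
    (hx : x ∈ cube 0 s) : ∃ z ∈ Z, ∀ i, |x i - z i| ≤ h := by
  rw [mem_cube_zero] at hx
  -- The minimum shifts the small cube back inside the large one while still containing `x`.
  obtain ⟨z, hzZ, hz⟩ := hZ.meets (WithLp.toLp 2 fun i => min (x i) (s - h)) (by
    intro y hy
    rw [mem_cube_zero]
    intro i
    have h1 := hy i
    simp only at h1
    have h2 : 0 ≤ min (x i) (s - h) := le_min (hx i).1 (by linarith)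
    have h3 := min_le_right (x i) (s - h)
    constructor <;> linarith)
  refine ⟨z, hzZ, fun i => ?_⟩
  have h1 := hz i
  simp only at h1
  have h3 := min_le_left (x i) (s - h)
  have h4 : x i - h ≤ min (x i) (s - h) := le_min (by linarith) (by linarith [(hx i).2])
  rw [abs_le]
  constructor <;> linarith

/-! ### Smallness on the cube and its propagation to the ball. -/

/-- A bound for the first partial derivatives on the cube by Markov's inequality. -/
theorem abs_fderivWithin_single_le {f : EuclideanSpace ℝ (Fin n) → ℝ} {d : ℕ} (hd : 1 ≤ d)
    {M m s : ℝ} (hs : 0 < s) (hf : ContDiffOn ℝ (d + 1 : ℕ) f (unitBall n))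
    (hM : ∀ z ∈ unitBall n, ∀ i : Fin (d + 1) → Fin n, |partialDeriv i f z| ≤ M)
    (hsub : cube 0 s ⊆ unitBall n) (hm : ∀ x ∈ cube 0 s, |f x| ≤ m)
    {p : EuclideanSpace ℝ (Fin n)} (hp : p ∈ cube 0 s) (i : Fin n) :
    |fderivWithin ℝ f (unitBall n) p (EuclideanSpace.single i 1)| ≤
      4 * (d : ℝ) ^ 2 / s * (m + M * (s / 2) ^ (d + 1) / d !) := by
  have hp' := mem_cube_zero.1 hp
  -- The sign is chosen so that a segment of length `s / 2` in direction `± e_i` stays in the cube.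
  obtain ⟨ε, hε, hε'⟩ : ∃ ε : ℝ, |ε| = 1 ∧
      ∀ t ∈ Icc 0 (s / 2), 0 ≤ p i + t * ε ∧ p i + t * ε ≤ s := by
    rcases le_total (p i) (s / 2) with h | h
    · exact ⟨1, by simp, fun t ht => ⟨by linarith [ht.1, (hp' i).1], by linarith [ht.2]⟩⟩
    · exact ⟨-1, by simp, fun t ht => ⟨by linarith [ht.2], by linarith [ht.1, (hp' i).2]⟩⟩
  set w : EuclideanSpace ℝ (Fin n) := ε • EuclideanSpace.single i 1 with hw
  have hwj : ∀ j, w j = if j = i then ε else 0 := by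
    intro j; simp [hw]
  have hcube : ∀ t ∈ Icc 0 (s / 2), p + t • w ∈ cube 0 s := by
    intro t ht
    rw [mem_cube_zero]
    intro j
    simp only [PiLp.add_apply, PiLp.smul_apply, smul_eq_mul, hwj]
    split_ifs with h
    · subst h; exact hε' t ht
    · simpa using hp' j
  have hball : ∀ t ∈ Icc 0 (s / 2), p + t • w ∈ unitBall n := fun t ht => hsub (hcube t ht)
  have hsum : ∑ j, |w j| = 1 := by
    simp [hwj, apply_ite abs, hε]
  have hr : (0 : ℝ) < s / 2 := by positivity
  have key := abs_derivWithin_zero_le hd hr (K := M) (m := m)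
    (g := fun t => f (p + t • w)) (by exact_mod_cast contDiffOn_comp_segment hf hball)
    (fun t ht => by
      have := abs_iteratedDerivWithin_comp_segment_le hf hM hr hball ht
      simpa [hsum] using this)
    (fun t ht => hm _ (hcube t ht))
  have hder : derivWithin (fun t : ℝ => f (p + t • w)) (Icc 0 (s / 2)) 0 =
      fderivWithin ℝ f (unitBall n) p w := by
    have h := iteratedDerivWithin_comp_segment uniqueDiffOn_unitBall hf hr hball (k := 1)
      (by omega) 0 ⟨le_rfl, hr.le⟩
    rw [iteratedDerivWithin_one] at h
    rw [h, zero_smul, add_zero, iteratedFDerivWithin_one_apply]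
    exact uniqueDiffOn_unitBall _ (hsub hp)
  rw [hder, hw, map_smul, smul_eq_mul, abs_mul, hε, one_mul] at key
  refine key.trans (le_of_eq ?_)
  field_simp
  ring

/-- A function vanishing on a sufficiently dense subset of the cube is small on the cube. -/
theorem abs_le_on_cube {f : EuclideanSpace ℝ (Fin n) → ℝ} {d : ℕ} (hd : 1 ≤ d)
    {M s h : ℝ} (hM0 : 0 ≤ M) (hs : 0 < s) (h0 : 0 < h) (hhs : h ≤ s)
    (hh : 8 * n * (d : ℝ) ^ 2 * h ≤ s) (hf : ContDiffOn ℝ (d + 1 : ℕ) f (unitBall n))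
    (hM : ∀ z ∈ unitBall n, ∀ i : Fin (d + 1) → Fin n, |partialDeriv i f z| ≤ M)
    (hsub : cube 0 s ⊆ unitBall n) {Z : Set (EuclideanSpace ℝ (Fin n))} (hZ : IsHDense s h Z)
    (hfZ : ∀ z ∈ Z, f z = 0) {x : EuclideanSpace ℝ (Fin n)} (hx : x ∈ cube 0 s) :
    |f x| ≤ M * (s / 2) ^ (d + 1) / d ! := by
  obtain ⟨y, hy, hmax⟩ := (isCompact_cube_zero hsub).exists_isMaxOn ⟨x, hx⟩
    (hf.continuousOn.mono hsub).abs
  set m := |f y| with hmdef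
  set ε := M * (s / 2) ^ (d + 1) / d ! with hε
  have hm : ∀ x ∈ cube 0 s, |f x| ≤ m := fun x hx => hmax hx
  refine (hm x hx).trans ?_
  have hm0 : 0 ≤ m := abs_nonneg _
  obtain ⟨z, hzZ, hz⟩ := hZ.exists_near hhs h0.le hy
  have hzc := hZ.subset_cube hzZ
  have hsegc : ∀ t ∈ Icc (0 : ℝ) 1, z + t • (y - z) ∈ cube 0 s := fun t ht =>
    (convex_cube 0 s).add_smul_sub_mem hzc hy ht
  have hseg : ∀ t ∈ Icc (0 : ℝ) 1, z + t • (y - z) ∈ unitBall n := fun t ht => hsub (hsegc t ht)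
  set B := 4 * (d : ℝ) ^ 2 / s * (m + ε) with hB
  have hbound : ∀ p ∈ cube 0 s, |fderivWithin ℝ f (unitBall n) p (y - z)| ≤ n * (h * B) := by
    intro p hp
    rw [← sum_smul_single (y - z), map_sum]
    refine (Finset.abs_sum_le_sum_abs _ _).trans ?_
    have : ∀ i ∈ (Finset.univ : Finset (Fin n)), |fderivWithin ℝ f (unitBall n) p
        ((y - z) i • EuclideanSpace.single i (1 : ℝ))| ≤ h * B := by
      intro i _
      rw [map_smul, smul_eq_mul, abs_mul]
      exact mul_le_mul (hz i) (abs_fderivWithin_single_le hd hs hf hM hsub hm hp i)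
        (abs_nonneg _) h0.le
    refine (Finset.sum_le_sum this).trans ?_
    simp
  have hder : ∀ t ∈ Icc (0 : ℝ) 1, HasDerivWithinAt (fun t : ℝ => f (z + t • (y - z)))
      (fderivWithin ℝ f (unitBall n) (z + t • (y - z)) (y - z)) (Icc 0 1) t := by
    intro t ht
    have h1 := (hf.differentiableOn (by simp) _ (hseg t ht)).hasFDerivWithinAt
    have h2 : HasDerivWithinAt (fun t : ℝ => z + t • (y - z)) (y - z) (Icc 0 1) t := by
      simpa using (((hasDerivAt_id t).smul_const (y - z)).const_add z).hasDerivWithinAt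
    exact h1.comp_hasDerivWithinAt t h2 hseg
  have hmv := norm_image_sub_le_of_norm_deriv_le_segment_01' hder
    (C := n * (h * B)) fun t ht => hbound _ (hsegc t (Ico_subset_Icc_self ht))
  simp only [one_smul, zero_smul, add_zero, add_sub_cancel, hfZ z hzZ, sub_zero,
    Real.norm_eq_abs] at hmv
  have hε0 : 0 ≤ ε := by positivity
  -- The density hypothesis makes the first factor at most `1`, so `m ≤ (m + ε) / 2` closes the
  -- self-referential bound.
  have h5 : (n : ℝ) * (h * B) = (8 * n * (d : ℝ) ^ 2 * h) / s * ((m + ε) / 2) := by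
    rw [hB]; field_simp; ring
  have h6 : (8 * n * (d : ℝ) ^ 2 * h) / s * ((m + ε) / 2) ≤ 1 * ((m + ε) / 2) := by
    refine mul_le_mul_of_nonneg_right ?_ (by linarith)
    rwa [div_le_one hs]
  have h7 : m ≤ n * (h * B) := hmv
  linarith

theorem sum_abs_le_card_mul_norm {n : ℕ} (w : EuclideanSpace ℝ (Fin n)) :
    ∑ i, |w i| ≤ n * ‖w‖ := by
  refine (Finset.sum_le_sum fun i _ => PiLp.norm_apply_le w i).trans ?_
  simp

theorem le_mul_of_dense {n d : ℕ} (hn : 1 ≤ n) (hd : 1 ≤ d) {M s h : ℝ} (hM0 : 0 ≤ M)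
    (hs : 0 < s) (hs1 : s ≤ 1 / 10) (h0 : 0 < h) (hhs : h ≤ s) (hh : 8 * n * (d : ℝ) ^ 2 * h ≤ s)
    {f : EuclideanSpace ℝ (Fin n) → ℝ} (hf : ContDiffOn ℝ (d + 1 : ℕ) f (unitBall n))
    (hM : ∀ z ∈ unitBall n, ∀ i : Fin (d + 1) → Fin n, |partialDeriv i f z| ≤ M)
    (hsub : cube 0 s ⊆ unitBall n) {Z : Set (EuclideanSpace ℝ (Fin n))} (hZ : IsHDense s h Z)
    (hfZ : ∀ z ∈ Z, f z = 0) {x : EuclideanSpace ℝ (Fin n)} (hx : x ∈ unitBall n) :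
    |f x| ≤ M / d ! * (4 * n * (8 * n) ^ d) := by
  set c : EuclideanSpace ℝ (Fin n) := WithLp.toLp 2 fun _ => s / 2 with hc
  have hcc : c ∈ cube 0 s := by
    rw [mem_cube_zero]; intro i; simp only [hc]; constructor <;> linarith
  have hcb := hsub hcc
  have hball : ∀ t ∈ Icc (0 : ℝ) 1, c + t • (x - c) ∈ unitBall n := fun t ht =>
    (convex_closedBall 0 1).add_smul_sub_mem hcb hx ht
  have hw : ‖x - c‖ ≤ 2 := by
    rw [unitBall, mem_closedBall_zero_iff] at hx hcb
    linarith [norm_sub_le x c]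
  have hcube : ∀ t ∈ Icc 0 (s / 4), c + t • (x - c) ∈ cube 0 s := by
    intro t ht
    rw [mem_cube_zero]
    intro i
    have h1 : |t * (x - c) i| ≤ s / 4 * 2 := by
      rw [abs_mul, abs_of_nonneg ht.1]
      exact mul_le_mul ht.2 ((PiLp.norm_apply_le (x - c) i).trans hw) (abs_nonneg _)
        (by positivity)
    have h2 : (c + t • (x - c)) i = s / 2 + t * (x - c) i := by simp [hc]
    rw [abs_le] at h1
    rw [h2]
    constructor <;> linarith [h1.1, h1.2]
  have hn1 : (1 : ℝ) ≤ n := by exact_mod_cast hn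
  -- Since `‖x - c‖ ≤ 2`, times up to `s / 4` move at most `s / 2` from the centre, within the cube;
  -- the `ℓ¹` norm is at most `2 * n`.
  have key := abs_apply_one_le hd (g := fun t => f (c + t • (x - c))) (τ := s / 4)
    (K := M * (2 * n) ^ (d + 1)) (m := M * (s / 2) ^ (d + 1) / d !) (by positivity) (by linarith)
    (by exact_mod_cast contDiffOn_comp_segment hf hball)
    (fun t ht => by
      refine (abs_iteratedDerivWithin_comp_segment_le hf hM one_pos hball ht).trans ?_
      gcongr
      refine (sum_abs_le_card_mul_norm _).trans ?_
      nlinarith)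
    (fun t ht => abs_le_on_cube hd hM0 hs h0 hhs hh hf hM hsub hZ hfZ (hcube t ht))
  simp only [one_smul, add_sub_cancel] at key
  refine key.trans ?_
  -- The growth factor `(16 / s) ^ d` cancels all but one power of `s`, leaving a bound uniform in
  -- `s`.
  have e : (M * (s / 2) ^ (d + 1) / d ! + M * (2 * n) ^ (d + 1) * (s / 4) ^ (d + 1) / d !) *
      (4 / (s / 4)) ^ d + M * (2 * n) ^ (d + 1) / d ! =
      M / d ! * (s / 2 * 8 ^ d + s / 2 * n * (8 * n) ^ d + 2 * n * (2 * n) ^ d) := by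
    have e1 : (s / 2) ^ d * (4 / (s / 4)) ^ d = 8 ^ d := by
      rw [← mul_pow]; congr 1; field_simp; norm_num
    have e2 : (2 * n : ℝ) ^ d * (s / 4) ^ d * (4 / (s / 4)) ^ d = (8 * n) ^ d := by
      rw [← mul_pow, ← mul_pow]; congr 1; field_simp; norm_num
    rw [← e1, ← e2]
    simp only [pow_succ]
    ring
  rw [e]
  refine mul_le_mul_of_nonneg_left ?_ (by positivity)
  have h1 : (8 : ℝ) ^ d ≤ (8 * n) ^ d := by gcongr; linarith
  have h2 : (2 * n : ℝ) ^ d ≤ (8 * n) ^ d := by gcongr; norm_num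
  have h3 : 0 ≤ (8 * n : ℝ) ^ d := by positivity
  have t1 : s / 2 * 8 ^ d ≤ n * (8 * n : ℝ) ^ d := by
    refine mul_le_mul (by linarith) h1 (by positivity) (by positivity)
  have t2 : s / 2 * n * (8 * n) ^ d ≤ n * (8 * n : ℝ) ^ d := by
    refine mul_le_mul_of_nonneg_right ?_ h3
    nlinarith
  have t3 : 2 * n * (2 * n : ℝ) ^ d ≤ 2 * n * (8 * n) ^ d := by gcongr
  linarith

/-! ### Comparison of constants. -/

/-- Exponent `n * d ≥ 2 * d` yields `(120 * n) ^ (-2 * d)`, which cancels the `n ^ (2 * d)` in the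
bound for `4 * n * (8 * n) ^ d` and absorbs `d + 1 ≤ 2 ^ d`. -/
theorem factorial_bound_mul_le_one {n d : ℕ} (hn : 2 ≤ n) (hd : 1 ≤ d) {s : ℝ} (hs : 0 < s)
    (hs1 : s ≤ 1 / 10) :
    ((d + 1 : ℕ) : ℝ) / 2 * (s / (12 * (n : ℝ))) ^ (n * d) * (4 * n * (8 * n) ^ d) ≤ 1 := by
  have hn2 : (2 : ℝ) ≤ n := by exact_mod_cast hn
  have hpos : (0 : ℝ) < n := by linarith
  have h1 : s / (12 * (n : ℝ)) ≤ 1 / (120 * n) := by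
    rw [div_le_div_iff₀ (by positivity) (by positivity)]; nlinarith
  have h2 : (s / (12 * (n : ℝ))) ^ (n * d) ≤ ((1 / (120 * n)) ^ 2) ^ d := by
    rw [← pow_mul]
    calc _ ≤ (1 / (120 * n) : ℝ) ^ (n * d) := by gcongr
      _ ≤ _ := by
        refine pow_le_pow_of_le_one (by positivity) ?_ (Nat.mul_le_mul_right d hn)
        rw [div_le_one (by positivity)]; linarith
  have h3 : ((d + 1 : ℕ) : ℝ) ≤ 2 ^ d := by exact_mod_cast Nat.lt_two_pow_self (n := d)
  have h4 : 2 * (n : ℝ) ≤ (2 * n) ^ d := le_self_pow₀ (by linarith) (by omega)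
  calc ((d + 1 : ℕ) : ℝ) / 2 * (s / (12 * (n : ℝ))) ^ (n * d) * (4 * n * (8 * n) ^ d)
      = ((d + 1 : ℕ) : ℝ) * (s / (12 * (n : ℝ))) ^ (n * d) * ((2 * n) * (8 * n) ^ d) := by ring
    _ ≤ 2 ^ d * ((1 / (120 * n)) ^ 2) ^ d * ((2 * n) ^ d * (8 * n) ^ d) := by gcongr
    _ = (2 * (1 / (120 * n)) ^ 2 * (2 * n * (8 * n))) ^ d := by simp only [mul_pow]
    _ ≤ 1 := by
        refine pow_le_one₀ (by positivity) ?_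
        have : (2 * (1 / (120 * n)) ^ 2 * (2 * n * (8 * n)) : ℝ) = 32 / 14400 := by
          field_simp; norm_num
        rw [this]; norm_num

/-- Supplies the density required by `abs_le_on_cube`; `n ≥ 2` enters through `d ^ 2 ≤ d ^ n`. -/
theorem mul_le_of_two_le {n d : ℕ} (hn : 2 ≤ n) {s h : ℝ} (hd : 1 ≤ d) (hs : 0 < s)
    (hs1 : s ≤ 1) (h_le : h ≤ s ^ n / (2 * 3 ^ (n - 1) * (4 * (d : ℝ)) ^ n)) :
    8 * n * (d : ℝ) ^ 2 * h ≤ s := by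
  have hd1 : (1 : ℝ) ≤ d := by exact_mod_cast hd
  rw [le_div_iff₀ (by positivity)] at h_le
  have hsn : s ^ n ≤ s := pow_le_of_le_one hs.le hs1 (by omega)
  rcases le_or_gt h 0 with h0 | h0
  · have : 8 * n * (d : ℝ) ^ 2 * h ≤ 0 := mul_nonpos_of_nonneg_of_nonpos (by positivity) h0
    linarith
  have h1 : (d : ℝ) ^ 2 ≤ d ^ n := pow_le_pow_right₀ hd1 hn
  have h2 : (8 * n : ℝ) ≤ 2 * 3 ^ (n - 1) * 4 ^ n := by
    have : n ≤ 4 ^ (n - 1) := by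
      have : n - 1 < 4 ^ (n - 1) := Nat.lt_pow_self (by norm_num)
      omega
    have h3 : (n : ℝ) ≤ 4 ^ (n - 1) := by exact_mod_cast this
    have h4 : (1 : ℝ) ≤ 3 ^ (n - 1) := one_le_pow₀ (by norm_num)
    have h5 : (4 : ℝ) ^ n = 4 * 4 ^ (n - 1) := by
      rw [← pow_succ']; congr 1; omega
    rw [h5]
    nlinarith
  calc 8 * n * (d : ℝ) ^ 2 * h ≤ 2 * 3 ^ (n - 1) * 4 ^ n * d ^ n * h := by gcongr
    _ = h * (2 * 3 ^ (n - 1) * (4 * (d : ℝ)) ^ n) := by rw [mul_pow]; ring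
    _ ≤ s := h_le.trans hsn

/-! ### The case `n = 1` and the conclusion. -/

/-- The one-dimensional case, by Lagrange interpolation. -/
theorem factorial_le_of_dense_one {d : ℕ} (hd : 1 ≤ d) {M s h : ℝ}
    (hs1 : s ≤ 1) (h0 : 0 < h) (hh : 3 * d * h ≤ s)
    {f : EuclideanSpace ℝ (Fin 1) → ℝ} (hf : ContDiffOn ℝ (d + 1 : ℕ) f (unitBall 1))
    (hM : ∀ z ∈ unitBall 1, ∀ i : Fin (d + 1) → Fin 1, |partialDeriv i f z| ≤ M)
    {Z : Set (EuclideanSpace ℝ (Fin 1))} (hZ : IsHDense s h Z)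
    (hfZ : ∀ z ∈ Z, f z = 0) {x : EuclideanSpace ℝ (Fin 1)} (hx : x ∈ unitBall 1) :
    (d + 1)! * |f x| ≤ M * 2 ^ (d + 1) := by
  set e : EuclideanSpace ℝ (Fin 1) := EuclideanSpace.single 0 1 with he
  have hcoord : ∀ y : EuclideanSpace ℝ (Fin 1), 0 + y 0 • e = y := by
    intro y; ext i; fin_cases i; simp [he]
  have hd1 : (1 : ℝ) ≤ d := by exact_mod_cast hd
  have hball : ∀ t ∈ Icc (-1 : ℝ) 1, 0 + t • e ∈ unitBall 1 := by
    intro t ht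
    rw [unitBall, mem_closedBall_zero_iff, zero_add, norm_smul]
    simpa [he] using abs_le.2 ht
  have hx1 : x 0 ∈ Icc (-1 : ℝ) 1 := by
    rw [unitBall, mem_closedBall_zero_iff] at hx
    exact abs_le.1 ((PiLp.norm_apply_le x 0).trans hx)
  -- Intervals of length `h` separated by gaps `h` force distinct nodes; they fit because `(2 * d +
  -- 1) * h ≤ 3 * d * h ≤ s`.
  have hnode : ∀ j : Fin (d + 1), ∃ z ∈ Z, 2 * h * j ≤ z 0 ∧ z 0 ≤ 2 * h * j + h := by
    intro j
    obtain ⟨z, hz, hz'⟩ := hZ.meets (WithLp.toLp 2 fun _ => 2 * h * j) (by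
      intro y hy
      rw [mem_cube_zero]
      intro i
      have h1 := hy i
      simp only at h1
      have hj : (j : ℝ) ≤ d := by exact_mod_cast Nat.lt_succ_iff.1 j.2
      have : 0 ≤ 2 * h * j := by positivity
      constructor
      · linarith
      · nlinarith)
    exact ⟨z, hz, hz' 0⟩
  choose z hzZ hz using hnode
  have hinj : Function.Injective fun j => z j 0 := by
    have : StrictMono fun j => z j 0 := by
      intro i j hij
      have h1 : (i : ℝ) + 1 ≤ j := by exact_mod_cast hij
      have h2 := (hz i).2
      have h3 := (hz j).1
      show z i 0 < z j 0
      nlinarith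
    exact this.injective
  have hz01 : ∀ j, 0 ≤ z j 0 ∧ z j 0 ≤ s := fun j =>
    mem_cube_zero.1 (hZ.subset_cube (hzZ j)) 0
  obtain ⟨ξ, hξ, h⟩ := exists_eq_iteratedDerivWithin_mul_prod (a := -1) (b := 1) (by norm_num)
    (k := d + 1) (g := fun t => f (0 + t • e)) (contDiffOn_comp_segment hf hball)
    (S := Finset.univ.map ⟨fun j => z j 0, hinj⟩) (by
      intro t ht
      simp only [Finset.coe_map, Function.Embedding.coeFn_mk, Finset.coe_univ, image_univ,
        mem_range] at ht
      obtain ⟨j, rfl⟩ := ht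
      exact ⟨by linarith [(hz01 j).1], (hz01 j).2.trans hs1⟩)
    (by simp) (by
      intro t ht
      simp only [Finset.mem_map, Finset.mem_univ, true_and, Function.Embedding.coeFn_mk] at ht
      obtain ⟨j, rfl⟩ := ht
      rw [hcoord]
      exact hfZ _ (hzZ j)) hx1
  rw [hcoord] at h
  have hder := abs_iteratedDerivWithin_comp_segment_le hf hM (by norm_num) hball hξ
  have hsum : ∑ i, |e i| = 1 := by simp [he]
  rw [hsum, one_pow, mul_one] at hder
  rw [← abs_of_nonneg (Nat.cast_nonneg (α := ℝ) (d + 1)!), ← abs_mul, h, abs_mul, Finset.abs_prod,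
    Finset.prod_map]
  refine mul_le_mul hder ?_ (Finset.prod_nonneg fun _ _ => abs_nonneg _)
    ((abs_nonneg _).trans hder)
  have hfac : ∀ j ∈ (Finset.univ : Finset (Fin (d + 1))), |x 0 - z j 0| ≤ 2 := fun j _ => by
    rw [abs_le]
    constructor <;> linarith [hx1.1, hx1.2, (hz01 j).1, (hz01 j).2]
  exact (Finset.prod_le_prod (fun _ _ => abs_nonneg _) hfac).trans (by simp)

/-- The rigidity estimate for a single function. -/
theorem le_of_dense {n d : ℕ} (hn : 1 ≤ n) (hd : 1 ≤ d) {M s h : ℝ}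
    (hs : 0 < s) (hs1 : s ≤ 1 / 10) (h0 : 0 < h) (hhs : h < s)
    (h_le : h ≤ s ^ n / (2 * 3 ^ (n - 1) * (4 * (d : ℝ)) ^ n))
    {f : EuclideanSpace ℝ (Fin n) → ℝ} (hf : ContDiffOn ℝ (d + 1 : ℕ) f (unitBall n))
    (hM0 : 0 ≤ M) (hM : ∀ z ∈ unitBall n, ∀ i : Fin (d + 1) → Fin n, |partialDeriv i f z| ≤ M)
    {Z : Set (EuclideanSpace ℝ (Fin n))} (hZb : Z ⊆ smallBall n) (hZ : IsHDense s h Z)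
    (hfZ : ∀ z ∈ Z, f z = 0) {x : EuclideanSpace ℝ (Fin n)} (hx : x ∈ unitBall n)
    (hfx : 1 ≤ |f x|) :
    ((d + 1)! : ℝ) / 2 * (s / (12 * (n : ℝ))) ^ (n * d) ≤ M := by
  have hd1 : (1 : ℝ) ≤ d := by exact_mod_cast hd
  rcases Nat.lt_or_ge 1 n with hn2 | hn1
  · have hh := mul_le_of_two_le hn2 hd hs (by linarith) h_le
    have hn1 : (1 : ℝ) ≤ n := by exact_mod_cast hn
    have h2 : 2 * h ≤ s := by
      have : 1 ≤ n * (d : ℝ) ^ 2 := one_le_mul_of_one_le_of_one_le hn1 (one_le_pow₀ hd1)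
      nlinarith
    have h1 := le_mul_of_dense hn hd hM0 hs hs1 h0 hhs.le hh hf hM
      (cube_subset_unitBall h0 h2 hZb hZ) hZ hfZ hx
    have h3 := factorial_bound_mul_le_one hn2 hd hs hs1
    set A := 4 * n * (8 * n : ℝ) ^ d with hA
    have hApos : 0 < A := by positivity
    have hdf : (0 : ℝ) < d ! := by positivity
    have h4 : (d ! : ℝ) ≤ M * A := by
      have h5 := hfx.trans h1
      rw [div_mul_eq_mul_div, le_div_iff₀ hdf] at h5
      linarith
    rw [← mul_le_mul_iff_left₀ hApos]
    calc _ = d ! * (((d + 1 : ℕ) : ℝ) / 2 * (s / (12 * (n : ℝ))) ^ (n * d) * A) := by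
          rw [Nat.factorial_succ]; push_cast; ring
      _ ≤ d ! * 1 := by gcongr
      _ ≤ M * A := by linarith
  · obtain rfl : n = 1 := le_antisymm hn1 hn
    have hh : 3 * d * h ≤ s := by
      rw [le_div_iff₀ (by positivity)] at h_le
      norm_num at h_le
      nlinarith
    have h1 := factorial_le_of_dense_one hd (by linarith) h0 hh hf hM hZ hfZ hx
    have h2 : ((d + 1)! : ℝ) ≤ M * 2 ^ (d + 1) := by
      refine le_trans ?_ h1
      exact le_mul_of_one_le_right (by positivity) hfx
    -- The crude bound `1 / 2` suffices: it exactly cancels `2 ^ (d + 1) / 2`.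
    have h3 : (s / (12 * ((1 : ℕ) : ℝ))) ^ (1 * d) ≤ (1 / 2) ^ d := by
      rw [one_mul]
      refine pow_le_pow_left₀ (by positivity) ?_ d
      norm_num
      linarith
    calc _ ≤ (M * 2 ^ (d + 1)) / 2 * (1 / 2) ^ d := by gcongr
      _ = M := by rw [one_div, inv_pow]; field_simp; ring

end Rigidity

theorem proposition2p3 (n d : ℕ) (hn : 1 ≤ n) (hd : 1 ≤ d) (s h : ℝ)
    (h_pos : 0 < h) (h_lt : h < s) (hs : s ≤ 1 / 10)
    (Z : Set (EuclideanSpace ℝ (Fin n)))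
    (hZ_ball : Z ⊆ Rigidity.smallBall n)
    (hZ_dense : Rigidity.IsHDense s h Z)
    (hZ_sep : Z.infsep = h / 3)
    (K₁ : ℝ) (hK₁ : K₁ = 2 * 3 ^ (n - 1) * (4 * (d : ℝ)) ^ n)
    (h_le : h ≤ s ^ n / K₁) :
    ENNReal.ofReal (((d + 1)! : ℝ) / 2 * (s / (12 * (n : ℝ))) ^ (n * d)) ≤
      Rigidity.rigidity d Z := by
  subst hK₁
  refine le_iInf₂ fun f hfU => ?_
  obtain ⟨hf, hfZ, hf0⟩ := hfU
  rcases eq_or_ne (Rigidity.derivMax (d + 1) f) ⊤ with htop | htop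
  · rw [htop]; exact le_top
  have hf' : ContDiffOn ℝ (d + 1 : ℕ) f (Rigidity.unitBall n) := by exact_mod_cast hf
  have hM : ∀ z ∈ Rigidity.unitBall n, ∀ i : Fin (d + 1) → Fin n,
      |Rigidity.partialDeriv i f z| ≤ (Rigidity.derivMax (d + 1) f).toReal := by
    intro z hz i
    rw [← ENNReal.ofReal_le_iff_le_toReal htop]
    exact (le_iSup (fun i => ENNReal.ofReal |Rigidity.partialDeriv i f z|) i).trans
      (le_iSup₂ (f := fun z (_ : z ∈ Rigidity.unitBall n) =>
        ⨆ i : Fin (d + 1) → Fin n, ENNReal.ofReal |Rigidity.partialDeriv i f z|) z hz)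
  obtain ⟨x, hx, hmax⟩ := (isCompact_closedBall (0 : EuclideanSpace ℝ (Fin n)) 1).exists_isMaxOn
    ⟨0, by simp⟩ hf'.continuousOn.abs
  -- `M_0(f)` is the supremum of `|f|`, attained at `x` by compactness.
  have hfx : 1 ≤ |f x| := by
    rw [← ENNReal.one_le_ofReal, ← hf0]
    refine iSup₂_le fun z hz => iSup_le fun i => ENNReal.ofReal_le_ofReal ?_
    simpa [Rigidity.partialDeriv] using hmax hz
  rw [ENNReal.ofReal_le_iff_le_toReal htop]
  exact Rigidity.le_of_dense hn hd (h_pos.trans h_lt) hs h_pos h_lt h_le hf' ENNReal.toReal_nonneg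
    hM hZ_ball hZ_dense hfZ hx hfx
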